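/- Let $\mathcal M=(V,\mathcal I)$ be a matroid on a finite ground set and let $f:2^{V}\to\mathbb R_{\ge 0}$ be monotone and submodular. Let $F(y)=\sum_{S\subseteq V} f(S)\prod_{v\in S}y_v\prod_{v\notin S}(1-y_v)$ be its multilinear extension. Let $\delta=1/n$ with $n\in\mathbb N$, $n\ge 1$. For a finite set $\mathcal R$ of pairs $(S,\tau)$ with $S\in\mathcal I$ and $\tau\in\delta\mathbb N$, let $$H(\mathcal R)=F\Big(\sum_{(S,\tau)\in\mathcal R}\delta\,\mathbf 1_S\Big),\qquad \mathsf{OPT}=\max_{|\mathcal R|\le 1/\delta}H(\mathcal R).$$ A run of the noisy ContinuousGreedy algorithm starts at $y(0)=0$; in each stage $\tau\in\{\delta,2\delta,\dots,1\}$ it selects some independent set $I(\tau)\in\mathcal I$ (possibly a suboptimal one) and sets $y(\tau)=y(\tau-\delta)+\delta\,\mathbf 1_{I(\tau)}$. It has nonnegative stage errors $\epsilon_\tau$ if for each $\tau\in\{\delta,2\delta,\dots,1\}$ $$H(\{(I(\tau'),\tau'):\tau'\le\tau\})-H(\{(I(\tau'),\tau'):\tau'<\tau\})\;\ge\;\delta\big(\mathsf{OPT}-H(\{(I(\tau'),\tau'):\tau'<\tau\})\big)-\epsilon_\tau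 ,\qquad \epsilon_\tau\ge 0 .$$ The algorithm outputs the random set $S$ obtained from $y(1)$ by randomized pipage rounding. That is: raise $y(1)$ to a point $y\ge y(1)$ of the base polytope. While $y$ is not integral, set $T:=V$, and while $T$ contains fractional coordinates of $y$, pick two of them, $i\ne j$. Let $y^+$ be obtained from $y$ by moving the amount $\min\{y_j,\ \min_{A\ni i,\,A\not\ni j}(r(A)-y(A))\}$ from $j$ to $i$, where $r$ is the rank function. Let $A^+=\{j\}$ if $y_j$ is strictly the smaller of the two, and otherwise let $A^+$ be a minimizing set $A$. Define $y^-,A^-$ likewise with $i,j$ exchanged. With probability $p=\|y^+-y\|/\|y^+-y^-\|$ (any $p\in[0,1]$ if this is $0/0$) set $(y,T):=(y^-,T\cap A^-)$, and otherwise set $(y,T):=(y^+,T\cap A^+)$. When $y$ is integral, output $S=\{v:y_v=1\}$. All unspecified choices are arbitrary. **Theorem.** Such an output exists, and for every way of making the unspecified choices the output satisfies $S\in\mathcal I$ and $$\mathbb E[f(S)]\;\ge\;\Big(1-\frac1e\Big)\max_{A\in\mathcal I}f(A)\;-\;\sum_{\tau\in\{\delta,2\delta,\dots,1\}}\epsilon_\tau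 .$$ The expectation is over the randomness of the rounding, for the given run $(I(\tau))_\tau$. -/

import Mathlib

open scoped NNReal ENNReal

namespace NoisyCG

noncomputable section

/-! ### Submodular functions, the multilinear extension, the feasible sets -/

/-- Diminishing returns: adding `s` to a smaller set helps at least as much. -/
def IsSubmodular {V : Type*} [DecidableEq V] (f : Finset V → ℝ) : Prop :=
  ∀ S S' : Finset V, S ⊆ S' → ∀ s, s ∉ S' → f (insert s S') - f S' ≤ f (insert s S) - f S

/-- The characteristic vector of `S`. -/
def charVec {V : Type*} [DecidableEq V] (S : Finset V) : V → ℝ :=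
  fun v => if v ∈ S then 1 else 0

/-- The multilinear extension `F(y) = ∑_S f(S) ∏_{v ∈ S} y_v ∏_{v ∉ S} (1 - y_v)`. -/
def multilinearExt {V : Type*} [Fintype V] [DecidableEq V] (f : Finset V → ℝ) (y : V → ℝ) : ℝ :=
  ∑ S : Finset V, f S * ((∏ v ∈ S, y v) * ∏ v ∈ Sᶜ, (1 - y v))

open Classical in
/-- The finite family of independent sets of `M`. -/
def indepSets {V : Type*} [Fintype V] (M : Matroid V) : Finset (Finset V) :=
  Finset.univ.filter (fun S : Finset V => M.Indep (S : Set V))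

theorem indepSets_nonempty {V : Type*} [Fintype V] (M : Matroid V) : (indepSets M).Nonempty :=
  ⟨∅, by simp [indepSets]⟩

/-- `max_{S independent} f(S)`. -/
def maxIndep {V : Type*} [Fintype V] (M : Matroid V) (f : Finset V → ℝ) : ℝ :=
  (indepSets M).sup' (indepSets_nonempty M) f

/-! ### Rows, the row objective and the continuous greedy trajectory, step size `δ = 1 / n` -/

/-- The row objective `H(R) = F(∑_{(S, τ) ∈ R} δ 1_S)` with `δ = 1 / n`.
A row is a pair `(S, k)`, where `k : ℕ` stands for the time `τ = k δ`. -/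
def rowObjective {V : Type*} [Fintype V] [DecidableEq V] (f : Finset V → ℝ) (n : ℕ)
    (R : Finset (Finset V × ℕ)) : ℝ :=
  multilinearExt f (∑ r ∈ R, (1 / (n : ℝ)) • charVec r.1)

/-- `OPT`, the maximum of `H` over all sets of at most `1 / δ = n` rows (the supremum is over a
non-empty finite set of values, as `H` does not depend on the time labels). -/
def rowOpt {V : Type*} [Fintype V] [DecidableEq V] (M : Matroid V) (f : Finset V → ℝ) (n : ℕ) :
    ℝ :=
  sSup {h : ℝ | ∃ R : Finset (Finset V × ℕ),
    (∀ r ∈ R, M.Indep (r.1 : Set V)) ∧ R.card ≤ n ∧ h = rowObjective f n R}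

/-- The rows `{(I(τ'), τ') : τ' ≤ k δ}` chosen in the first `k` stages; stages are numbered
from `1`. -/
def rowsUpTo {V : Type*} [DecidableEq V] (I : ℕ → Finset V) (k : ℕ) : Finset (Finset V × ℕ) :=
  (Finset.Icc 1 k).image (fun s => (I s, s))

/-- The trajectory `y(0) = 0`, `y(τ) = y(τ - δ) + δ 1_{I(τ)}`; `trajectory n I k` is `y(k δ)`. -/
def trajectory {V : Type*} [DecidableEq V] (n : ℕ) (I : ℕ → Finset V) : ℕ → V → ℝ
  | 0 => 0
  | k + 1 => trajectory n I k + (1 / (n : ℝ)) • charVec (I (k + 1))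

/-- `ε k` is an error of stage `k` of the run `I`:
`H(rows up to k) - H(rows before k) ≥ δ (OPT - H(rows before k)) - ε k`. -/
def IsStageError {V : Type*} [Fintype V] [DecidableEq V] (M : Matroid V) (f : Finset V → ℝ)
    (n : ℕ) (I : ℕ → Finset V) (k : ℕ) (ε : ℝ) : Prop :=
  rowObjective f n (rowsUpTo I k) - rowObjective f n (rowsUpTo I (k - 1)) ≥
    (1 / (n : ℝ)) * (rowOpt M f n - rowObjective f n (rowsUpTo I (k - 1))) - ε

/-! ### Randomized pipage rounding -/

/-- The base polytope: the convex hull of the characteristic vectors of the bases. -/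
def basePolytope {V : Type*} [DecidableEq V] (M : Matroid V) : Set (V → ℝ) :=
  convexHull ℝ {y | ∃ B : Finset V, M.IsBase (B : Set V) ∧ y = charVec B}

/-- The slack `r(A) - y(A)` of the rank constraint of `A`. -/
def rankSlack {V : Type*} (M : Matroid V) (y : V → ℝ) (A : Finset V) : ℝ :=
  ((M.eRk (A : Set V)).toNat : ℝ) - ∑ v ∈ A, y v

/-- Move an amount `d` from coordinate `j` to coordinate `i`. -/
def shift {V : Type*} [DecidableEq V] (y : V → ℝ) (i j : V) (d : ℝ) : V → ℝ :=
  y + d • (Pi.single i 1 - Pi.single j 1)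

/-- `HitConstraint M y i j y' A`: the subroutine, called with `(y, i, j)`, may return `(y', A)`.
It moves mass from `j` to `i` until a rank constraint of some `A` with `i ∈ A`, `j ∉ A` becomes
tight, or until coordinate `j` becomes zero (and then `A = {j}`). Ties are broken arbitrarily. -/
inductive HitConstraint {V : Type*} [DecidableEq V] (M : Matroid V) (y : V → ℝ) (i j : V) :
    (V → ℝ) → Finset V → Prop
  | tight (A : Finset V) (hi : i ∈ A) (hj : j ∉ A)
      (hmin : ∀ B : Finset V, i ∈ B → j ∉ B → rankSlack M y A ≤ rankSlack M y B)
      (hle : rankSlack M y A ≤ y j) :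
      HitConstraint M y i j (shift y i j (rankSlack M y A)) A
  | zero (hlt : ∀ B : Finset V, i ∈ B → j ∉ B → y j < rankSlack M y B) :
      HitConstraint M y i j (shift y i j (y j)) {j}

/-- With probability `p` draw from `μ`, otherwise from `ν`. -/
def mix {β : Type*} (p : ℝ≥0) (hp : p ≤ 1) (μ ν : PMF β) : PMF β :=
  (PMF.ofFintype (fun b : Bool => cond b (p : ℝ≥0∞) (1 - p)) (by simp [hp])).bind
    (fun b => cond b μ ν)

/-- A coordinate is fractional if it lies strictly between `0` and `1`. -/
def IsFractional {V : Type*} (y : V → ℝ) (v : V) : Prop := 0 < y v ∧ y v < 1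

/-- A vector is integral if all its coordinates are `0` or `1`. -/
def IsIntegral {V : Type*} (y : V → ℝ) : Prop := ∀ v, y v = 0 ∨ y v = 1

open Classical in
/-- `PipageLoop M y T μ`: some execution of the loops of randomized pipage rounding (some way of
making the arbitrary choices along every branch of the coin flips), started with the current point
`y` and the current tight set `T`, halts on every branch and has output distribution `μ`.

* `done`: the point is integral, it is the characteristic vector of the output;
* `restart`: `T` has no fractional element left, so `T` is reset to the ground set;
* `step`: two fractional elements `i`, `j` of `T` are picked, `HitConstraint` is called in both
  directions, giving `(y⁺, A⁺)` and `(y⁻, A⁻)`; with probability `p = ‖y⁺ - y‖ / ‖y⁺ - y⁻‖` the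
  state becomes `(y⁻, T ∩ A⁻)` and otherwise `(y⁺, T ∩ A⁺)`. If `y⁺ = y⁻ = y`, every `p` is
  allowed. (The two differences are parallel, so any norm gives the same ratio.) -/
inductive PipageLoop {V : Type*} [Fintype V] [DecidableEq V] (M : Matroid V) :
    (V → ℝ) → Finset V → PMF (Finset V) → Prop
  | done (y : V → ℝ) (T : Finset V) (hy : IsIntegral y) :
      PipageLoop M y T (PMF.pure (Finset.univ.filter (fun v => y v = 1)))
  | restart (y : V → ℝ) (T : Finset V) (μ : PMF (Finset V)) (hy : ¬ IsIntegral y)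
      (hT : ∀ v ∈ T, ¬ IsFractional y v) (hμ : PipageLoop M y Finset.univ μ) :
      PipageLoop M y T μ
  | step (y : V → ℝ) (T : Finset V) (i j : V) (hi : i ∈ T) (hj : j ∈ T) (hij : i ≠ j)
      (hfi : IsFractional y i) (hfj : IsFractional y j)
      (yp ym : V → ℝ) (Ap Am : Finset V)
      (hplus : HitConstraint M y i j yp Ap) (hminus : HitConstraint M y j i ym Am)
      (p : ℝ≥0) (hp : p ≤ 1) (hratio : (p : ℝ) * ‖yp - ym‖ = ‖yp - y‖)
      (μp μm : PMF (Finset V))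
      (hμm : PipageLoop M ym (T ∩ Am) μm) (hμp : PipageLoop M yp (T ∩ Ap) μp) :
      PipageLoop M y T (mix p hp μm μp)

/-- `PipageRound M y μ`: `μ` is an output distribution of randomized pipage rounding of `y`.
The point `y` of the matroid polytope is first raised to a point `z ≥ y` of the base polytope
(if `y` already lies there, `z = y`), to which the loops are then applied. -/
def PipageRound {V : Type*} [Fintype V] [DecidableEq V] (M : Matroid V) (y : V → ℝ)
    (μ : PMF (Finset V)) : Prop :=
  ∃ z ∈ basePolytope M, y ≤ z ∧ PipageLoop M z Finset.univ μ

/-- `μ` is an output distribution of the noisy continuous greedy algorithm with step size `1 / n`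
whose stages selected the independent sets `I 1, …, I n`: pipage rounding of `y(1)`. -/
def IsOutput {V : Type*} [Fintype V] [DecidableEq V] (M : Matroid V) (n : ℕ) (I : ℕ → Finset V)
    (μ : PMF (Finset V)) : Prop :=
  PipageRound M (trajectory n I n) μ

/-- The expectation of `f(S)` for `S` distributed according to `μ`. -/
def expect {V : Type*} [Fintype V] (μ : PMF (Finset V)) (f : Finset V → ℝ) : ℝ :=
  ∑ S : Finset V, (μ S).toReal * f S

end

end NoisyCG

/-!
Write `H k` for the row objective after `k` stages. A stage error bound says that the gap
`OPT - H k` shrinks by the factor `1 - 1 / n` up to the error, so that after `n` stages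
`H n ≥ (1 - (1 - 1 / n) ^ n) OPT - ∑ ε ≥ (1 - 1 / e) OPT - ∑ ε` (`rowObjective_ge`). Moreover
`OPT ≥ f A` for every independent `A`, because `n` copies of `A` form an admissible set of rows
with objective `F(1_A) = f A` (`maxIndep_le_rowOpt`), and `H n = F(y(1)) ≤ F(z)` for the raised
point `z`, because `F` is monotone on the cube.

Rounding does not lose value. Along the direction `e_i - e_j` the extension `F` is a quadratic
polynomial whose leading coefficient is nonnegative by submodularity, and the coin of each step is
biased so that the current point is a martingale; hence the expectation of `F` does not decrease
(`multilinearExt_le_mix`). The loops keep the point inside the polytope described by the rank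
constraints (`RankFeasible`), and an integral point of that polytope is the characteristic vector
of an independent set. Edmonds' theorem that this polytope is the hull of the bases is not needed,
only the inclusion of the hull.

The loops can always be run to the end. If `T` is tight and contains a fractional coordinate then
it contains two, since `y(T)` is an integer. A step either makes a coordinate integral or replaces
`T` by a smaller tight set, by submodularity of the rank, that still contains a fractional
coordinate; integral coordinates never change again. So the pair consisting of the number of
fractional coordinates and the size of `T` decreases lexicographically
(`exists_pipageLoop_of_tight`).
-/

namespace NoisyCG

/-! ### The multilinear extension -/

/-- The multilinear extension over subsets of `U` only, `E[f(S)]` for `S ⊆ U` random with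
independent memberships of probabilities `y v`. Expanding `U` one element at a time is how the
properties of the multilinear extension are proved. -/
noncomputable def multilinearOn {V : Type*} [DecidableEq V] (U : Finset V) (f : Finset V → ℝ)
    (y : V → ℝ) : ℝ :=
  ∑ S ∈ U.powerset, f S * ((∏ v ∈ S, y v) * ∏ v ∈ U \ S, (1 - y v))

section Extension

variable {V : Type*} [DecidableEq V]

theorem multilinearExt_eq_multilinearOn [Fintype V] (f : Finset V → ℝ) (y : V → ℝ) :
    multilinearExt f y = multilinearOn Finset.univ f y := by
  simp [multilinearExt, multilinearOn, Finset.compl_eq_univ_sdiff]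

theorem multilinearOn_empty (f : Finset V → ℝ) (y : V → ℝ) : multilinearOn ∅ f y = f ∅ := by
  simp [multilinearOn]

theorem multilinearOn_insert {U : Finset V} {i : V} (hi : i ∉ U) (f : Finset V → ℝ)
    (y : V → ℝ) :
    multilinearOn (insert i U) f y =
      (1 - y i) * multilinearOn U f y +
        y i * multilinearOn U (fun S => f (insert i S)) y := by
  unfold multilinearOn
  rw [Finset.sum_powerset_insert hi, Finset.mul_sum, Finset.mul_sum]
  congr 1
  · refine Finset.sum_congr rfl fun S hS => ?_
    have hiS : i ∉ S := fun h => hi (Finset.mem_powerset.1 hS h)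
    rw [Finset.insert_sdiff_of_notMem _ hiS, Finset.prod_insert (by simp [hi])]
    ring
  · refine Finset.sum_congr rfl fun S hS => ?_
    have hiS : i ∉ S := fun h => hi (Finset.mem_powerset.1 hS h)
    rw [Finset.prod_insert hiS, Finset.insert_sdiff_insert, Finset.sdiff_insert_of_notMem hi]
    ring

theorem multilinearOn_congr {U : Finset V} {f : Finset V → ℝ} {y z : V → ℝ}
    (h : ∀ v ∈ U, y v = z v) : multilinearOn U f y = multilinearOn U f z := by
  refine Finset.sum_congr rfl fun S hS => ?_
  have h1 : ∏ v ∈ S, y v = ∏ v ∈ S, z v :=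
    Finset.prod_congr rfl fun v hv => h v (Finset.mem_powerset.1 hS hv)
  have h2 : ∏ v ∈ U \ S, (1 - y v) = ∏ v ∈ U \ S, (1 - z v) :=
    Finset.prod_congr rfl fun v hv => by rw [h v (Finset.mem_sdiff.1 hv).1]
  rw [h1, h2]

theorem multilinearOn_mono_left {U : Finset V} {f g : Finset V → ℝ} {y : V → ℝ}
    (h0 : ∀ v, 0 ≤ y v) (h1 : ∀ v, y v ≤ 1) (h : ∀ S ⊆ U, f S ≤ g S) :
    multilinearOn U f y ≤ multilinearOn U g y := by
  refine Finset.sum_le_sum fun S hS => ?_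
  refine mul_le_mul_of_nonneg_right (h S (Finset.mem_powerset.1 hS)) ?_
  exact mul_nonneg (Finset.prod_nonneg fun v _ => h0 v)
    (Finset.prod_nonneg fun v _ => sub_nonneg.2 (h1 v))

theorem multilinearOn_mono_right (U : Finset V) {y z : V → ℝ}
    (h0 : ∀ v, 0 ≤ y v) (hyz : y ≤ z) (h1 : ∀ v, z v ≤ 1) :
    ∀ f : Finset V → ℝ, Monotone f → multilinearOn U f y ≤ multilinearOn U f z := by
  induction U using Finset.induction_on with
  | empty => intro f _; simp [multilinearOn_empty]
  | insert i U hi ih =>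
    intro f hf
    rw [multilinearOn_insert hi, multilinearOn_insert hi]
    have ha := ih f hf
    have hb := ih (fun S => f (insert i S)) fun S S' h => hf (Finset.insert_subset_insert i h)
    have hab : multilinearOn U f y ≤ multilinearOn U (fun S => f (insert i S)) y :=
      multilinearOn_mono_left h0 (fun v => (hyz v).trans (h1 v))
        fun S _ => hf (Finset.subset_insert i S)
    have hyi := hyz i
    nlinarith [mul_nonneg (sub_nonneg.2 hyi) (sub_nonneg.2 hab),
      mul_nonneg (sub_nonneg.2 (h1 i)) (sub_nonneg.2 ha),
      mul_nonneg ((h0 i).trans hyi) (sub_nonneg.2 hb)]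

theorem multilinearOn_charVec (U A : Finset V) :
    ∀ f : Finset V → ℝ, multilinearOn U f (charVec A) = f (A ∩ U) := by
  induction U using Finset.induction_on with
  | empty => intro f; simp [multilinearOn_empty]
  | insert i U hi ih =>
    intro f
    rw [multilinearOn_insert hi, ih, ih]
    by_cases h : i ∈ A
    · simp [charVec, h, Finset.inter_insert_of_mem]
    · simp [charVec, h, Finset.inter_insert_of_notMem]

theorem multilinearExt_charVec [Fintype V] (f : Finset V → ℝ) (A : Finset V) :
    multilinearExt f (charVec A) = f A := by
  rw [multilinearExt_eq_multilinearOn, multilinearOn_charVec, Finset.inter_univ]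

theorem multilinearExt_mono [Fintype V] {f : Finset V → ℝ} (hf : Monotone f) {y z : V → ℝ}
    (h0 : ∀ v, 0 ≤ y v) (hyz : y ≤ z) (h1 : ∀ v, z v ≤ 1) :
    multilinearExt f y ≤ multilinearExt f z := by
  simpa only [multilinearExt_eq_multilinearOn] using
    multilinearOn_mono_right Finset.univ h0 hyz h1 f hf

theorem multilinearExt_le_univ [Fintype V] {f : Finset V → ℝ} (hf : Monotone f) {y : V → ℝ}
    (h0 : ∀ v, 0 ≤ y v) (h1 : ∀ v, y v ≤ 1) : multilinearExt f y ≤ f Finset.univ := by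
  rw [← multilinearExt_charVec f Finset.univ]
  exact multilinearExt_mono hf h0 (fun v => by simpa [charVec] using h1 v)
    fun v => by simp [charVec]

@[simp] theorem shift_apply_left {y : V → ℝ} {i j : V} (hij : i ≠ j) (d : ℝ) :
    shift y i j d i = y i + d := by
  simp [shift, hij]

@[simp] theorem shift_apply_right {y : V → ℝ} {i j : V} (hij : i ≠ j) (d : ℝ) :
    shift y i j d j = y j - d := by
  simp [shift, hij.symm, sub_eq_add_neg]

theorem shift_apply_of_ne {y : V → ℝ} {i j v : V} (hi : v ≠ i) (hj : v ≠ j) (d : ℝ) :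
    shift y i j d v = y v := by
  simp [shift, hi, hj]

theorem shift_swap (y : V → ℝ) (i j : V) (d : ℝ) : shift y j i d = shift y i j (-d) := by
  simp only [shift]
  rw [neg_smul, ← smul_neg, neg_sub]

/-- The multilinear extension of a submodular function is a convex quadratic polynomial along a
direction that exchanges two coordinates. -/
theorem multilinearExt_shift [Fintype V] {f : Finset V → ℝ} (hf : IsSubmodular f) {y : V → ℝ}
    (h0 : ∀ v, 0 ≤ y v) (h1 : ∀ v, y v ≤ 1) {i j : V} (hij : i ≠ j) :
    ∃ b c : ℝ, 0 ≤ c ∧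
      ∀ t, multilinearExt f (shift y i j t) = multilinearExt f y + b * t + c * t ^ 2 := by
  set U : Finset V := (Finset.univ.erase i).erase j with hU
  have hjU : j ∉ U := by simp [hU]
  have hiU : i ∉ insert j U := by simp [hU, hij]
  have huniv : (Finset.univ : Finset V) = insert i (insert j U) := by
    rw [hU, Finset.insert_erase (by simp [hij.symm]), Finset.insert_erase (Finset.mem_univ i)]
  have key : ∀ z : V → ℝ, (∀ v ∈ U, z v = y v) → multilinearExt f z =
      (1 - z i) * ((1 - z j) * multilinearOn U f y +
        z j * multilinearOn U (fun S => f (insert j S)) y) +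
      z i * ((1 - z j) * multilinearOn U (fun S => f (insert i S)) y +
        z j * multilinearOn U (fun S => f (insert i (insert j S))) y) := by
    intro z hz
    rw [multilinearExt_eq_multilinearOn, huniv, multilinearOn_insert hiU,
      multilinearOn_insert hjU, multilinearOn_insert hjU]
    simp only [multilinearOn_congr hz]
  have hmix : multilinearOn U (fun S => f (insert i (insert j S))) y + multilinearOn U f y ≤
      multilinearOn U (fun S => f (insert i S)) y +
        multilinearOn U (fun S => f (insert j S)) y := by
    have hadd : ∀ g h : Finset V → ℝ, multilinearOn U g y + multilinearOn U h y =
        multilinearOn U (fun S => g S + h S) y := by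
      intro g h
      simp [multilinearOn, add_mul, Finset.sum_add_distrib]
    rw [hadd, hadd]
    refine multilinearOn_mono_left h0 h1 fun S hS => ?_
    have hiS : i ∉ insert j S := fun h => hiU (Finset.insert_subset_insert j hS h)
    have := hf S (insert j S) (Finset.subset_insert j S) i hiS
    linarith
  have hyU := key y fun _ _ => rfl
  have hs : ∀ t, ∀ v ∈ U, shift y i j t v = y v := fun t v hv =>
    shift_apply_of_ne (ne_of_mem_of_not_mem (Finset.mem_insert_of_mem hv) hiU)
      (ne_of_mem_of_not_mem hv hjU) t
  generalize multilinearOn U (fun S => f (insert i (insert j S))) y = D at *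
  generalize multilinearOn U (fun S => f (insert i S)) y = C at *
  generalize multilinearOn U (fun S => f (insert j S)) y = B at *
  generalize multilinearOn U f y = A at *
  refine ⟨(C - B) + (y j - y i) * (A - B - C + D), B + C - A - D, by linarith, fun t => ?_⟩
  rw [key _ (hs t), hyU, shift_apply_left hij, shift_apply_right hij]
  ring

end Extension

/-! ### The polytope of the rank constraints -/

/-- The inequality description of the base polytope: nonnegative coordinates, `y(A) ≤ r(A)` for
all `A`, and equality for the ground set. -/
structure RankFeasible {V : Type*} [Fintype V] (M : Matroid V) (y : V → ℝ) : Prop where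
  nonneg : ∀ v, 0 ≤ y v
  slack_nonneg : ∀ A : Finset V, 0 ≤ rankSlack M y A
  slack_univ : rankSlack M y Finset.univ = 0

theorem eRk_toNat_cast {V : Type*} (M : Matroid V) (A : Finset V) :
    ((M.eRk (A : Set V)).toNat : ℕ∞) = M.eRk (A : Set V) :=
  ENat.natCast_toNat ((M.eRk_le_encard _).trans_lt A.finite_toSet.encard_lt_top).ne

theorem eRk_toNat_le_card {V : Type*} (M : Matroid V) (A : Finset V) :
    (M.eRk (A : Set V)).toNat ≤ A.card := by
  have h := M.eRk_le_encard (A : Set V)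
  rw [← eRk_toNat_cast, Set.encard_coe_eq_coe_finsetCard] at h
  exact_mod_cast h

theorem charVec_nonneg {V : Type*} [DecidableEq V] (A : Finset V) (v : V) : 0 ≤ charVec A v := by
  unfold charVec
  split_ifs <;> norm_num

theorem charVec_le_one {V : Type*} [DecidableEq V] (A : Finset V) (v : V) : charVec A v ≤ 1 := by
  unfold charVec
  split_ifs <;> norm_num

theorem sum_charVec {V : Type*} [DecidableEq V] (A B : Finset V) :
    ∑ v ∈ A, charVec B v = ((A ∩ B).card : ℝ) := by
  simp [charVec]

theorem rankSlack_inter_add_union_le {V : Type*} [DecidableEq V] (M : Matroid V) (y : V → ℝ)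
    (A B : Finset V) :
    rankSlack M y (A ∩ B) + rankSlack M y (A ∪ B) ≤ rankSlack M y A + rankSlack M y B := by
  have h := M.eRk_inter_add_eRk_union_le (A : Set V) (B : Set V)
  rw [← Finset.coe_inter, ← Finset.coe_union, ← eRk_toNat_cast M (A ∩ B),
    ← eRk_toNat_cast M (A ∪ B), ← eRk_toNat_cast M A, ← eRk_toNat_cast M B] at h
  have h' : ((M.eRk ((A ∩ B : Finset V) : Set V)).toNat : ℝ) +
      (M.eRk ((A ∪ B : Finset V) : Set V)).toNat ≤
      (M.eRk (A : Set V)).toNat + (M.eRk (B : Set V)).toNat := by exact_mod_cast h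
  have hs := Finset.sum_union_inter (s₁ := A) (s₂ := B) (f := y)
  unfold rankSlack
  linarith

theorem RankFeasible.le_one {V : Type*} [Fintype V] {M : Matroid V} {y : V → ℝ}
    (hy : RankFeasible M y) (v : V) : y v ≤ 1 := by
  have h := hy.slack_nonneg {v}
  have h1 : ((M.eRk (({v} : Finset V) : Set V)).toNat : ℝ) ≤ 1 := by
    exact_mod_cast eRk_toNat_le_card M {v}
  simp only [rankSlack, Finset.sum_singleton] at h
  linarith

section Polytope

variable {V : Type*} [Fintype V] [DecidableEq V] {M : Matroid V}

theorem rankFeasible_charVec {B : Finset V} (hB : M.IsBase (B : Set V)) :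
    RankFeasible M (charVec B) := by
  refine ⟨charVec_nonneg B, fun A => ?_, ?_⟩
  · have hind : M.Indep ((A ∩ B : Finset V) : Set V) :=
      hB.indep.subset (by simp)
    have h : M.eRk ((A ∩ B : Finset V) : Set V) ≤ M.eRk (A : Set V) :=
      M.eRk_mono (by simp)
    rw [hind.eRk_eq_encard, Set.encard_coe_eq_coe_finsetCard, ← eRk_toNat_cast] at h
    have h' : ((A ∩ B).card : ℝ) ≤ (M.eRk (A : Set V)).toNat := by exact_mod_cast h
    rw [rankSlack, sum_charVec]
    linarith
  · have h : M.eRk ((Finset.univ : Finset V) : Set V) = B.card := by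
      rw [Finset.coe_univ, Matroid.eRk_univ_eq, ← hB.encard_eq_eRank,
        Set.encard_coe_eq_coe_finsetCard]
    rw [rankSlack, sum_charVec, h]
    simp

theorem rankFeasible_of_mem_basePolytope {y : V → ℝ} (hy : y ∈ basePolytope M) :
    RankFeasible M y := by
  suffices h : basePolytope M ⊆ {y | RankFeasible M y} from h hy
  refine convexHull_min (fun y => ?_) fun y hy z hz a b ha hb hab => ?_
  · rintro ⟨B, hB, rfl⟩
    exact rankFeasible_charVec hB
  · have hs : ∀ A, rankSlack M (a • y + b • z) A = a * rankSlack M y A + b * rankSlack M z A := by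
      intro A
      simp only [rankSlack, Pi.add_apply, Pi.smul_apply, smul_eq_mul, Finset.sum_add_distrib,
        ← Finset.mul_sum]
      linear_combination -((M.eRk (A : Set V)).toNat : ℝ) * hab
    refine ⟨fun v => ?_, fun A => ?_, ?_⟩
    · exact add_nonneg (mul_nonneg ha (hy.nonneg v)) (mul_nonneg hb (hz.nonneg v))
    · rw [hs]
      exact add_nonneg (mul_nonneg ha (hy.slack_nonneg A)) (mul_nonneg hb (hz.slack_nonneg A))
    · rw [hs, hy.slack_univ, hz.slack_univ]
      simp

theorem charVec_filter_eq_one {y : V → ℝ} (hy : IsIntegral y)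
    [DecidablePred fun v => y v = 1] :
    charVec (Finset.univ.filter fun v => y v = 1) = y := by
  funext v
  rcases hy v with h | h <;> simp [charVec, h]

/-- The support `S` of an integral feasible point is independent, as `|S| = y(S) ≤ r(S)`. -/
theorem RankFeasible.indep_filter {y : V → ℝ} (hy : RankFeasible M y) (hint : IsIntegral y)
    [DecidablePred fun v => y v = 1] :
    M.Indep ((Finset.univ.filter fun v => y v = 1 : Finset V) : Set V) := by
  set S := Finset.univ.filter fun v => y v = 1 with hS
  have h := hy.slack_nonneg S
  have hsum : ∑ v ∈ S, y v = S.card := by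
    rw [← charVec_filter_eq_one hint, sum_charVec, ← hS, Finset.inter_self]
  rw [rankSlack, hsum, sub_nonneg] at h
  have h' : S.card ≤ (M.eRk (S : Set V)).toNat := by exact_mod_cast h
  rw [Matroid.indep_iff_eRk_eq_encard_of_finite S.finite_toSet,
    Set.encard_coe_eq_coe_finsetCard, ← eRk_toNat_cast]
  exact_mod_cast le_antisymm (eRk_toNat_le_card M S) h'

end Polytope

/-! ### The steps of pipage rounding -/

section Step

variable {V : Type*} [DecidableEq V]

theorem rankSlack_shift (M : Matroid V) (y : V → ℝ) (i j : V) (d : ℝ) (A : Finset V) :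
    rankSlack M (shift y i j d) A =
      rankSlack M y A - d * ((if i ∈ A then 1 else 0) - (if j ∈ A then 1 else 0)) := by
  have h : ∀ k : V, ∑ v ∈ A, (Pi.single k 1 : V → ℝ) v = if k ∈ A then 1 else 0 := fun k => by
    simp [Pi.single_apply]
  simp only [rankSlack, shift, Pi.add_apply, Pi.smul_apply, Pi.sub_apply, smul_eq_mul,
    Finset.sum_add_distrib, ← Finset.mul_sum, Finset.sum_sub_distrib, h]
  ring

theorem norm_shift_sub_shift [Fintype V] (y : V → ℝ) (i j : V) (s t : ℝ) :
    ‖shift y i j s - shift y i j t‖ = |s - t| * ‖(Pi.single i 1 - Pi.single j 1 : V → ℝ)‖ := by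
  rw [shift, shift, add_sub_add_left_eq_sub, ← sub_smul, norm_smul, Real.norm_eq_abs]

theorem norm_single_sub_single_pos [Fintype V] {i j : V} (hij : i ≠ j) :
    0 < ‖(Pi.single i 1 - Pi.single j 1 : V → ℝ)‖ := by
  rw [norm_pos_iff]
  intro h
  have := congrFun h i
  simp [hij] at this

/-- The condition on the bias of the coin, in terms of the amounts that are moved. -/
theorem norm_ratio_iff [Fintype V] {y : V → ℝ} {i j : V} (hij : i ≠ j) {a b p : ℝ}
    (ha : 0 ≤ a) (hb : 0 ≤ b) :
    p * ‖shift y i j a - shift y j i b‖ = ‖shift y i j a - y‖ ↔ p * (a + b) = a := by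
  have h0 : ‖shift y i j a - y‖ = ‖shift y i j a - shift y i j 0‖ := by simp [shift]
  rw [h0, shift_swap y i j b, norm_shift_sub_shift, norm_shift_sub_shift, sub_neg_eq_add,
    sub_zero, abs_of_nonneg (add_nonneg ha hb), abs_of_nonneg ha, ← mul_assoc]
  exact mul_left_inj' (norm_single_sub_single_pos hij).ne'

variable [Fintype V] {M : Matroid V}

theorem RankFeasible.shift {y : V → ℝ} (hy : RankFeasible M y) {i j : V} (hij : i ≠ j) {d : ℝ}
    (hd : 0 ≤ d) (hdj : d ≤ y j)
    (hdA : ∀ B : Finset V, i ∈ B → j ∉ B → d ≤ rankSlack M y B) :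
    RankFeasible M (shift y i j d) := by
  refine ⟨fun v => ?_, fun A => ?_, ?_⟩
  · by_cases hvi : v = i
    · subst hvi
      rw [shift_apply_left hij]
      exact add_nonneg (hy.nonneg v) hd
    by_cases hvj : v = j
    · subst hvj
      rw [shift_apply_right hij]
      linarith
    rw [shift_apply_of_ne hvi hvj]
    exact hy.nonneg v
  · rw [rankSlack_shift]
    have h := hy.slack_nonneg A
    by_cases hi : i ∈ A <;> by_cases hj : j ∈ A
    · simpa [hi, hj] using h
    · simpa [hi, hj] using hdA A hi hj
    · simp only [hi, hj, if_true, if_false]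
      linarith
    · simpa [hi, hj] using h
  · simp [rankSlack_shift, hy.slack_univ]

/-- What a call of the subroutine achieves: a feasible point, and either a new tight set that
separates `i` from `j`, or the coordinate `j` has become zero. -/
theorem HitConstraint.spec {y y' : V → ℝ} {i j : V} {A : Finset V}
    (h : HitConstraint M y i j y' A) (hy : RankFeasible M y) (hij : i ≠ j) :
    (∃ d, 0 ≤ d ∧ y' = NoisyCG.shift y i j d) ∧ RankFeasible M y' ∧
      ((i ∈ A ∧ j ∉ A ∧ rankSlack M y' A = 0) ∨ (A = {j} ∧ y' j = 0)) := by
  cases h with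
  | tight _ hi hj hmin hle =>
    refine ⟨⟨_, hy.slack_nonneg A, rfl⟩, hy.shift hij (hy.slack_nonneg A) hle hmin,
      Or.inl ⟨hi, hj, ?_⟩⟩
    simp [rankSlack_shift, hi, hj]
  | zero hlt =>
    refine ⟨⟨_, hy.nonneg j, rfl⟩,
      hy.shift hij (hy.nonneg j) le_rfl fun B hi hj => (hlt B hi hj).le, Or.inr ⟨rfl, ?_⟩⟩
    simp [shift_apply_right hij]

theorem exists_hitConstraint (M : Matroid V) (y : V → ℝ) {i j : V} (hij : i ≠ j) :
    ∃ y' A, HitConstraint M y i j y' A := by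
  obtain ⟨A, hA, hmin⟩ := Finset.exists_min_image
    (Finset.univ.filter fun A : Finset V => i ∈ A ∧ j ∉ A) (rankSlack M y)
    ⟨{i}, by simp [hij.symm]⟩
  simp only [Finset.mem_filter, Finset.mem_univ, true_and] at hA hmin
  rcases le_or_gt (rankSlack M y A) (y j) with h | h
  · exact ⟨_, _, .tight A hA.1 hA.2 (fun B hi hj => hmin B ⟨hi, hj⟩) h⟩
  · exact ⟨_, _, .zero fun B hi hj => h.trans_le (hmin B ⟨hi, hj⟩)⟩

/-- The coin of a step is fair enough: if `p = a / (a + b)`, then the point that is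
`y - b (e_i - e_j)` with probability `p` and `y + a (e_i - e_j)` otherwise has mean `y`, and by
convexity the expected value of the multilinear extension is at least its value at `y`. -/
theorem multilinearExt_le_mix {f : Finset V → ℝ} (hf : IsSubmodular f) {y : V → ℝ}
    (h0 : ∀ v, 0 ≤ y v) (h1 : ∀ v, y v ≤ 1) {i j : V} (hij : i ≠ j) {a b p : ℝ}
    (hp0 : 0 ≤ p) (hp1 : p ≤ 1) (hp : p * (a + b) = a) :
    multilinearExt f y ≤ p * multilinearExt f (shift y j i b) +
      (1 - p) * multilinearExt f (shift y i j a) := by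
  obtain ⟨β, γ, hγ, h⟩ := multilinearExt_shift hf h0 h1 hij
  rw [shift_swap y i j b, h, h]
  have h2 : 0 ≤ γ * (p * b ^ 2 + (1 - p) * a ^ 2) :=
    mul_nonneg hγ (add_nonneg (mul_nonneg hp0 (sq_nonneg _))
      (mul_nonneg (sub_nonneg.2 hp1) (sq_nonneg _)))
  linear_combination h2 + β * hp

end Step

theorem mix_apply {β : Type*} (p : ℝ≥0) (hp : p ≤ 1) (μ ν : PMF β) (x : β) :
    mix p hp μ ν x = p * μ x + (1 - p) * ν x := by
  simp [mix, PMF.bind_apply]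

theorem mem_support_of_mem_support_mix {β : Type*} {p : ℝ≥0} {hp : p ≤ 1} {μ ν : PMF β} {x : β}
    (h : x ∈ (mix p hp μ ν).support) : x ∈ μ.support ∨ x ∈ ν.support := by
  simp only [PMF.mem_support_iff, mix_apply] at h ⊢
  by_contra! hc
  simp [hc.1, hc.2] at h

theorem expect_mix {V : Type*} [Fintype V] (p : ℝ≥0) (hp : p ≤ 1) (μ ν : PMF (Finset V))
    (f : Finset V → ℝ) :
    expect (mix p hp μ ν) f = p * expect μ f + (1 - p) * expect ν f := by
  unfold expect
  rw [Finset.mul_sum, Finset.mul_sum, ← Finset.sum_add_distrib]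
  refine Finset.sum_congr rfl fun S _ => ?_
  have h1 : ((1 : ℝ≥0∞) - p).toReal = 1 - p := by
    rw [ENNReal.toReal_sub_of_le (by exact_mod_cast hp) ENNReal.one_ne_top]
    simp
  rw [mix_apply, ENNReal.toReal_add, ENNReal.toReal_mul, ENNReal.toReal_mul, h1]
  · simp only [ENNReal.coe_toReal]
    ring
  · exact ENNReal.mul_ne_top ENNReal.coe_ne_top (μ.apply_ne_top S)
  · exact ENNReal.mul_ne_top (ENNReal.sub_ne_top ENNReal.one_ne_top) (ν.apply_ne_top S)


/-! ### Correctness of the rounding -/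

section Loop

variable {V : Type*} [Fintype V] [DecidableEq V] {M : Matroid V}

/-- Every output distribution of the loops is supported on independent sets and loses nothing of
the value of the multilinear extension. -/
theorem PipageLoop.indep_and_le_expect {f : Finset V → ℝ} (hf : IsSubmodular f) {y : V → ℝ}
    {T : Finset V} {μ : PMF (Finset V)} (h : PipageLoop M y T μ) (hy : RankFeasible M y) :
    (∀ S ∈ μ.support, M.Indep (S : Set V)) ∧ multilinearExt f y ≤ expect μ f := by
  induction h with
  | done y T hint =>
    refine ⟨fun S hS => ?_, ?_⟩
    · rw [PMF.mem_support_pure_iff] at hS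
      subst hS
      exact hy.indep_filter hint
    · nth_rewrite 1 [← charVec_filter_eq_one hint]
      rw [multilinearExt_charVec]
      simp [expect, PMF.pure_apply, apply_ite ENNReal.toReal]
  | restart y T μ _ _ _ ih => exact ih hy
  | step y T i j hi hj hij hfi hfj yp ym Ap Am hplus hminus p hp hratio μp μm _ _ ihm ihp =>
    obtain ⟨⟨a, ha, hya⟩, hyp, -⟩ := hplus.spec hy hij
    obtain ⟨⟨b, hb, hyb⟩, hym, -⟩ := hminus.spec hy hij.symm
    obtain ⟨hsm, hem⟩ := ihm hym
    obtain ⟨hsp, hep⟩ := ihp hyp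
    refine ⟨fun S hS => (mem_support_of_mem_support_mix hS).elim (hsm S) (hsp S), ?_⟩
    have hpab : (p : ℝ) * (a + b) = a := by
      rwa [hya, hyb, norm_ratio_iff hij ha hb] at hratio
    have hp1 : (p : ℝ) ≤ 1 := by exact_mod_cast hp
    have hmix := multilinearExt_le_mix hf hy.nonneg hy.le_one hij p.coe_nonneg hp1 hpab
    rw [← hya, ← hyb] at hmix
    rw [expect_mix]
    exact hmix.trans (add_le_add (mul_le_mul_of_nonneg_left hem p.coe_nonneg)
      (mul_le_mul_of_nonneg_left hep (sub_nonneg.2 hp1)))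

end Loop

/-! ### Termination of the rounding -/

open Classical in
/-- The set of fractional coordinates of `y`. -/
noncomputable def fractionalSet {V : Type*} [Fintype V] (y : V → ℝ) : Finset V :=
  Finset.univ.filter fun v => IsFractional y v

theorem mem_fractionalSet {V : Type*} [Fintype V] {y : V → ℝ} {v : V} :
    v ∈ fractionalSet y ↔ IsFractional y v := by
  simp [fractionalSet]

theorem RankFeasible.exists_isFractional {V : Type*} [Fintype V] {M : Matroid V} {y : V → ℝ}
    (hy : RankFeasible M y) (hint : ¬ IsIntegral y) : ∃ v, IsFractional y v := by
  simp only [IsIntegral, not_forall, not_or] at hint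
  obtain ⟨v, h0, h1⟩ := hint
  exact ⟨v, lt_of_le_of_ne (hy.nonneg v) (Ne.symm h0), lt_of_le_of_ne (hy.le_one v) h1⟩

section Termination

variable {V : Type*} [Fintype V] [DecidableEq V] {M : Matroid V}

/-- A tight set with a fractional coordinate has a second one: its coordinates sum to an
integer. -/
theorem exists_ne_isFractional {y : V → ℝ} (hy : RankFeasible M y) {T : Finset V}
    (hT : rankSlack M y T = 0) {i : V} (hi : i ∈ T) (hfi : IsFractional y i) :
    ∃ j ∈ T, i ≠ j ∧ IsFractional y j := by
  classical
  by_contra! hc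
  have hsum : ∑ v ∈ T.erase i, y v = ((T.erase i).filter fun v => y v = 1).card := by
    rw [Finset.card_filter, Nat.cast_sum]
    refine Finset.sum_congr rfl fun v hv => ?_
    obtain ⟨hvi, hvT⟩ := Finset.mem_erase.1 hv
    have hnf := hc v hvT hvi.symm
    by_cases h1 : y v = 1
    · simp [h1]
    · have h0 : y v = 0 := by
        by_contra h0
        exact hnf ⟨lt_of_le_of_ne (hy.nonneg v) (Ne.symm h0), lt_of_le_of_ne (hy.le_one v) h1⟩
      simp [h0]
  rw [rankSlack, ← Finset.add_sum_erase T y hi, hsum] at hT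
  obtain ⟨h0, h1⟩ := hfi
  set r := (M.eRk (T : Set V)).toNat
  set c := ((T.erase i).filter fun v => y v = 1).card
  have hlo : (c : ℝ) < r := by linarith
  have hhi : (r : ℝ) < c + 1 := by linarith
  have hlo' : c < r := by exact_mod_cast hlo
  have hhi' : r < c + 1 := by exact_mod_cast hhi
  omega

theorem rankSlack_inter_eq_zero {y : V → ℝ} (hy : RankFeasible M y) {A B : Finset V}
    (hA : rankSlack M y A = 0) (hB : rankSlack M y B = 0) : rankSlack M y (A ∩ B) = 0 := by
  have h := rankSlack_inter_add_union_le M y A B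
  have h1 := hy.slack_nonneg (A ∩ B)
  have h2 := hy.slack_nonneg (A ∪ B)
  linarith

theorem fractionalSet_shift_subset {y : V → ℝ} {i j : V} (hfi : IsFractional y i)
    (hfj : IsFractional y j) (d : ℝ) : fractionalSet (shift y i j d) ⊆ fractionalSet y := by
  intro v hv
  rw [mem_fractionalSet] at hv ⊢
  by_cases hvi : v = i
  · rwa [hvi]
  by_cases hvj : v = j
  · rwa [hvj]
  rwa [IsFractional, shift_apply_of_ne hvi hvj] at hv

/-- From a feasible point and a tight set with a fractional element, some execution of the loops
halts on every branch. -/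
theorem exists_pipageLoop_of_tight (m : ℕ) : ∀ (t : ℕ) (y : V → ℝ) (T : Finset V),
    RankFeasible M y → rankSlack M y T = 0 → (∃ v ∈ T, IsFractional y v) →
    (fractionalSet y).card = m → T.card = t → ∃ μ, PipageLoop M y T μ := by
  induction m using Nat.strong_induction_on with
  | _ m ihm =>
  -- With fewer fractional coordinates, `T` may also be free of fractional elements: then the loop
  -- is over or restarts with the ground set, which is tight.
  have hless : ∀ (y : V → ℝ) (T : Finset V), RankFeasible M y → (fractionalSet y).card < m →
      (rankSlack M y T = 0 ∨ ∀ v ∈ T, ¬ IsFractional y v) → ∃ μ, PipageLoop M y T μ := by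
    intro y T hy hm hT
    by_cases hv : ∃ v ∈ T, IsFractional y v
    · have hT' : rankSlack M y T = 0 := hT.resolve_right (by simpa using hv)
      exact ihm _ hm _ y T hy hT' hv rfl rfl
    · push Not at hv
      by_cases hint : IsIntegral y
      · exact ⟨_, .done y T hint⟩
      · obtain ⟨v, hfv⟩ := hy.exists_isFractional hint
        obtain ⟨μ, hμ⟩ := ihm _ hm _ y Finset.univ hy hy.slack_univ
          ⟨v, Finset.mem_univ v, hfv⟩ rfl rfl
        exact ⟨μ, .restart y T μ hint hv hμ⟩
  intro t
  induction t using Nat.strong_induction_on with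
  | _ t iht =>
  rintro y T hy hT ⟨i, hi, hfi⟩ hm ht
  obtain ⟨j, hj, hij, hfj⟩ := exists_ne_isFractional hy hT hi hfi
  -- Either outcome of the coin lowers the measure; the two differ by exchanging `i` and `j`.
  have hbranch : ∀ (i j : V), i ∈ T → j ∈ T → i ≠ j → IsFractional y i → IsFractional y j →
      ∀ (y' : V → ℝ) (A : Finset V), HitConstraint M y i j y' A →
        ∃ μ, PipageLoop M y' (T ∩ A) μ := by
    intro i j hi hj hij hfi hfj y' A h
    obtain ⟨⟨d, -, hyd⟩, hy', hA⟩ := h.spec hy hij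
    have hT' : rankSlack M y' T = 0 := by rw [hyd, rankSlack_shift, hT]; simp [hi, hj]
    have hsub : fractionalSet y' ⊆ fractionalSet y := by
      rw [hyd]
      exact fractionalSet_shift_subset hfi hfj d
    rcases lt_or_ge (fractionalSet y').card m with hlt | hge
    · refine hless y' _ hy' hlt ?_
      rcases hA with ⟨-, -, hA⟩ | ⟨rfl, hj0⟩
      · exact Or.inl (rankSlack_inter_eq_zero hy' hT' hA)
      · refine Or.inr fun v hv hfv => ?_
        obtain rfl := Finset.mem_singleton.1 (Finset.mem_inter.1 hv).2
        exact hfv.1.ne' hj0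
    · have heq := Finset.eq_of_subset_of_card_le hsub (hm.trans_le hge)
      have hfi' : IsFractional y' i := by
        rwa [← mem_fractionalSet, heq, mem_fractionalSet]
      have hfj' : IsFractional y' j := by
        rwa [← mem_fractionalSet, heq, mem_fractionalSet]
      rcases hA with ⟨hiA, hjA, hA⟩ | ⟨-, hj0⟩
      · refine iht (T ∩ A).card ?_ y' _ hy' (rankSlack_inter_eq_zero hy' hT' hA)
          ⟨i, Finset.mem_inter.2 ⟨hi, hiA⟩, hfi'⟩ (by rw [heq, hm]) rfl
        rw [← ht]
        refine Finset.card_lt_card (Finset.ssubset_iff_subset_ne.2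
          ⟨Finset.inter_subset_left, fun h => hjA ?_⟩)
        exact (Finset.mem_inter.1 (h.symm ▸ hj)).2
      · exact absurd hj0 hfj'.1.ne'
  obtain ⟨yp, Ap, hp⟩ := exists_hitConstraint M y hij
  obtain ⟨ym, Am, hm'⟩ := exists_hitConstraint M y hij.symm
  obtain ⟨μp, hμp⟩ := hbranch i j hi hj hij hfi hfj yp Ap hp
  obtain ⟨μm, hμm⟩ := hbranch j i hj hi hij.symm hfj hfi ym Am hm'
  obtain ⟨⟨a, ha, hya⟩, -⟩ := hp.spec hy hij
  obtain ⟨⟨b, hb, hyb⟩, -⟩ := hm'.spec hy hij.symm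
  obtain ⟨p, hp1, hpab⟩ : ∃ p : ℝ≥0, p ≤ 1 ∧ (p : ℝ) * (a + b) = a := by
    -- If `a + b = 0` then no mass moves and every bias is allowed.
    rcases (add_nonneg ha hb).eq_or_lt with h | h
    · exact ⟨0, zero_le_one, by simp; linarith⟩
    · refine ⟨(a / (a + b)).toNNReal, ?_, ?_⟩
      · exact Real.toNNReal_le_one.2 (div_le_one_of_le₀ (by linarith) h.le)
      · rw [Real.coe_toNNReal _ (div_nonneg ha h.le), div_mul_cancel₀ a h.ne']
  have hratio : (p : ℝ) * ‖yp - ym‖ = ‖yp - y‖ := by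
    rwa [hya, hyb, norm_ratio_iff hij ha hb]
  exact ⟨_, .step y T i j hi hj hij hfi hfj yp ym Ap Am hp hm' p hp1 hratio μp μm hμm hμp⟩

theorem exists_pipageLoop {y : V → ℝ} (hy : RankFeasible M y) :
    ∃ μ, PipageLoop M y Finset.univ μ := by
  by_cases hint : IsIntegral y
  · exact ⟨_, .done y _ hint⟩
  · obtain ⟨v, hv⟩ := hy.exists_isFractional hint
    exact exists_pipageLoop_of_tight _ _ y _ hy hy.slack_univ ⟨v, Finset.mem_univ v, hv⟩ rfl rfl

end Termination

/-! ### The continuous greedy trajectory -/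

section Trajectory

variable {V : Type*} [DecidableEq V]

theorem trajectory_eq_sum (n : ℕ) (I : ℕ → Finset V) (k : ℕ) :
    trajectory n I k = ∑ s ∈ Finset.Icc 1 k, (1 / (n : ℝ)) • charVec (I s) := by
  induction k with
  | zero => simp [trajectory]
  | succ k ih => rw [trajectory, Finset.sum_Icc_succ_top (by omega), ih]

theorem sum_rowsUpTo (n : ℕ) (I : ℕ → Finset V) (k : ℕ) :
    ∑ r ∈ rowsUpTo I k, (1 / (n : ℝ)) • charVec r.1 = trajectory n I k := by
  rw [rowsUpTo, Finset.sum_image fun a _ b _ h => (Prod.ext_iff.1 h).2, trajectory_eq_sum]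

theorem charVec_mono {A B : Finset V} (h : A ⊆ B) : charVec A ≤ charVec B := by
  intro v
  by_cases hA : v ∈ A
  · simp [charVec, hA, h hA]
  · simpa [charVec, hA] using charVec_nonneg B v

theorem rowSum_nonneg (n : ℕ) (R : Finset (Finset V × ℕ)) (v : V) :
    0 ≤ (∑ r ∈ R, (1 / (n : ℝ)) • charVec r.1) v := by
  rw [Finset.sum_apply]
  exact Finset.sum_nonneg fun r _ => mul_nonneg (by positivity) (charVec_nonneg _ v)

theorem rowSum_le_one {n : ℕ} {R : Finset (Finset V × ℕ)} (hR : R.card ≤ n) (v : V) :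
    (∑ r ∈ R, (1 / (n : ℝ)) • charVec r.1) v ≤ 1 := by
  rw [Finset.sum_apply]
  calc ∑ r ∈ R, ((1 / (n : ℝ)) • charVec r.1) v ≤ ∑ _r ∈ R, 1 / (n : ℝ) :=
        Finset.sum_le_sum fun r _ => mul_le_of_le_one_right (by positivity) (charVec_le_one _ v)
    _ = R.card / n := by rw [Finset.sum_const, nsmul_eq_mul, mul_one_div]
    _ ≤ 1 := div_le_one_of_le₀ (by exact_mod_cast hR) (by positivity)

variable [Fintype V] {M : Matroid V}

/-- Extending every selected independent set to a base raises the trajectory to the base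
polytope. -/
theorem exists_mem_basePolytope_ge {n : ℕ} (hn : 0 < n) {I : ℕ → Finset V}
    (hI : ∀ k ∈ Finset.Icc 1 n, M.Indep (I k : Set V)) :
    ∃ z ∈ basePolytope M, trajectory n I n ≤ z := by
  have hB : ∀ k ∈ Finset.Icc 1 n, ∃ B : Finset V, M.IsBase (B : Set V) ∧ I k ⊆ B := by
    intro k hk
    obtain ⟨B, hB, hIB⟩ := (hI k hk).exists_isBase_superset
    refine ⟨B.toFinite.toFinset, by simpa using hB, fun v hv => ?_⟩
    simpa using hIB hv
  choose! B hB hIB using hB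
  refine ⟨∑ k ∈ Finset.Icc 1 n, (1 / (n : ℝ)) • charVec (B k), ?_, ?_⟩
  · refine (convex_convexHull ℝ _).sum_mem (fun _ _ => by positivity) ?_
      fun k hk => subset_convexHull ℝ _ ⟨B k, hB k hk, rfl⟩
    have : (n : ℝ) ≠ 0 := by positivity
    simp [this]
  · rw [trajectory_eq_sum]
    exact Finset.sum_le_sum fun k hk =>
      smul_le_smul_of_nonneg_left (charVec_mono (hIB k hk)) (by positivity)

theorem rowObjective_le_rowOpt {f : Finset V → ℝ} (hf : Monotone f) {n : ℕ}
    {R : Finset (Finset V × ℕ)} (hR : ∀ r ∈ R, M.Indep (r.1 : Set V)) (hcard : R.card ≤ n) :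
    rowObjective f n R ≤ rowOpt M f n := by
  refine le_csSup ⟨f Finset.univ, ?_⟩ ⟨R, hR, hcard, rfl⟩
  rintro _ ⟨R', -, hcard', rfl⟩
  exact multilinearExt_le_univ hf (rowSum_nonneg n R') (rowSum_le_one hcard')

theorem rowObjective_empty (f : Finset V → ℝ) (n : ℕ) : rowObjective f n ∅ = f ∅ := by
  rw [← multilinearExt_charVec f ∅, rowObjective, Finset.sum_empty]
  congr 1

theorem maxIndep_le_rowOpt {f : Finset V → ℝ} (hf : Monotone f) {n : ℕ} (hn : 0 < n) :
    maxIndep M f ≤ rowOpt M f n := by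
  refine Finset.sup'_le _ _ fun A hA => ?_
  have hA : M.Indep (A : Set V) := by simpa [indepSets] using hA
  have hval : rowObjective f n (rowsUpTo (fun _ => A) n) = f A := by
    have : (n : ℝ) ≠ 0 := by positivity
    rw [rowObjective, sum_rowsUpTo, trajectory_eq_sum, ← Finset.sum_smul]
    simp [this, multilinearExt_charVec]
  rw [← hval]
  refine rowObjective_le_rowOpt hf (fun r hr => ?_) ?_
  · obtain ⟨s, -, rfl⟩ := Finset.mem_image.1 hr
    exact hA
  · exact Finset.card_image_le.trans (by simp)

/-- The greedy recursion: each stage shrinks the gap to the optimum by the factor `1 - 1 / n`, up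
to the stage error. -/
theorem rowOpt_sub_rowObjective_le {f : Finset V → ℝ} (hf0 : ∀ S, 0 ≤ f S) {n : ℕ} (hn : 0 < n)
    {I : ℕ → Finset V} {ε : ℕ → ℝ} (hε0 : ∀ k ∈ Finset.Icc 1 n, 0 ≤ ε k)
    (hε : ∀ k ∈ Finset.Icc 1 n, IsStageError M f n I k (ε k)) {k : ℕ} (hk : k ≤ n) :
    rowOpt M f n - rowObjective f n (rowsUpTo I k) ≤
      (1 - 1 / (n : ℝ)) ^ k * rowOpt M f n + ∑ s ∈ Finset.Icc 1 k, ε s := by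
  induction k with
  | zero =>
    have h : rowsUpTo I 0 = ∅ := by simp [rowsUpTo]
    rw [h, rowObjective_empty]
    simpa using hf0 ∅
  | succ k ih =>
    have hmem : k + 1 ∈ Finset.Icc 1 n := Finset.mem_Icc.2 ⟨by omega, hk⟩
    have hstage := hε _ hmem
    rw [IsStageError, Nat.add_sub_cancel] at hstage
    have hsum : 0 ≤ ∑ s ∈ Finset.Icc 1 k, ε s :=
      Finset.sum_nonneg fun s hs => hε0 s (by
        rw [Finset.mem_Icc] at hs ⊢
        omega)
    have hn1 : (1 : ℝ) ≤ n := by exact_mod_cast hn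
    have hδ0 : 0 ≤ 1 / (n : ℝ) := by positivity
    have hδ1 : 0 ≤ 1 - 1 / (n : ℝ) := sub_nonneg.2 (div_le_one_of_le₀ hn1 (by positivity))
    rw [Finset.sum_Icc_succ_top (by omega), pow_succ']
    have h := mul_le_mul_of_nonneg_left (ih (by omega)) hδ1
    have h' := mul_nonneg hδ0 hsum
    linarith

theorem rowObjective_ge {f : Finset V → ℝ} (hf0 : ∀ S, 0 ≤ f S) (hf : Monotone f) {n : ℕ}
    (hn : 0 < n) {I : ℕ → Finset V} {ε : ℕ → ℝ} (hε0 : ∀ k ∈ Finset.Icc 1 n, 0 ≤ ε k)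
    (hε : ∀ k ∈ Finset.Icc 1 n, IsStageError M f n I k (ε k)) :
    (1 - 1 / Real.exp 1) * rowOpt M f n - ∑ k ∈ Finset.Icc 1 n, ε k ≤
      rowObjective f n (rowsUpTo I n) := by
  have hopt : 0 ≤ rowOpt M f n :=
    (hf0 ∅).trans ((rowObjective_empty f n).symm.trans_le
      (rowObjective_le_rowOpt hf (by simp) (by simp)))
  have hexp : (1 - 1 / (n : ℝ)) ^ n ≤ 1 / Real.exp 1 := by
    rw [one_div (Real.exp 1), ← Real.exp_neg]
    exact Real.one_sub_div_pow_le_exp_neg (by exact_mod_cast hn)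
  have h := rowOpt_sub_rowObjective_le hf0 hn hε0 hε le_rfl
  have h' := mul_le_mul_of_nonneg_right hexp hopt
  linarith

end Trajectory

end NoisyCG

theorem mainTheorem4 {V : Type*} [Fintype V] [DecidableEq V] (M : Matroid V)
    (f : Finset V → ℝ) (hf_nonneg : ∀ S, 0 ≤ f S) (hf_mono : Monotone f)
    (hf_sub : NoisyCG.IsSubmodular f)
    (n : ℕ) (hn : 0 < n)
    (I : ℕ → Finset V) (hI : ∀ k ∈ Finset.Icc 1 n, M.Indep (I k : Set V))
    (ε : ℕ → ℝ) (hε_nonneg : ∀ k ∈ Finset.Icc 1 n, 0 ≤ ε k)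
    (hε : ∀ k ∈ Finset.Icc 1 n, NoisyCG.IsStageError M f n I k (ε k)) :
    (∃ μ : PMF (Finset V), NoisyCG.IsOutput M n I μ) ∧
    ∀ μ : PMF (Finset V), NoisyCG.IsOutput M n I μ →
      (∀ S ∈ μ.support, M.Indep (S : Set V)) ∧
      NoisyCG.expect μ f ≥
        (1 - 1 / Real.exp 1) * NoisyCG.maxIndep M f - ∑ k ∈ Finset.Icc 1 n, ε k := by
  refine ⟨?_, ?_⟩
  · obtain ⟨z, hz, hyz⟩ := NoisyCG.exists_mem_basePolytope_ge hn hI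
    obtain ⟨μ, hμ⟩ := NoisyCG.exists_pipageLoop (NoisyCG.rankFeasible_of_mem_basePolytope hz)
    exact ⟨μ, z, hz, hyz, hμ⟩
  · rintro μ ⟨z, hz, hyz, hμ⟩
    have hfeas := NoisyCG.rankFeasible_of_mem_basePolytope hz
    obtain ⟨hind, hexp⟩ := hμ.indep_and_le_expect hf_sub hfeas
    refine ⟨hind, ?_⟩
    have h0 : ∀ v, 0 ≤ NoisyCG.trajectory n I n v := by
      rw [← NoisyCG.sum_rowsUpTo]
      exact NoisyCG.rowSum_nonneg n _
    have hraise := NoisyCG.multilinearExt_mono hf_mono h0 hyz hfeas.le_one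
    have hgreedy := NoisyCG.rowObjective_ge hf_nonneg hf_mono hn hε_nonneg hε
    rw [NoisyCG.rowObjective, NoisyCG.sum_rowsUpTo] at hgreedy
    have he : 0 ≤ 1 - 1 / Real.exp 1 :=
      sub_nonneg.2 (div_le_one_of_le₀ (Real.one_le_exp zero_le_one) (Real.exp_pos 1).le)
    have hopt := mul_le_mul_of_nonneg_left
      (NoisyCG.maxIndep_le_rowOpt (M := M) hf_mono hn) he
    linarith
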